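/- Let $\mathbb{K}$ be $\mathbb{R}$ or $\mathbb{C}$. A Fréchet algebra $(\mathcal A,p_n)$ is an associative, not necessarily unital, $\mathbb K$-algebra that is a complete Hausdorff topological vector space whose topology is defined by an increasing sequence $(p_n)_{n\in\mathbb N}$ of submultiplicative seminorms. For a closed two-sided ideal $I$ of $\mathcal A$, the quotient $\mathcal A/I$ is a Fréchet algebra with the seminorms $\hat p_n(a+I)=\inf\{p_n(a+b): b\in I\}$. For a Fréchet algebra $\mathcal B$ let $\mathcal B\widehat\otimes\mathcal B$ be the completed projective tensor product, a $\mathcal B$-bimodule by $a\cdot(b\otimes c)=ab\otimes c$ and $(b\otimes c)\cdot a=b\otimes ca$, and let $\pi_{\mathcal B}:\mathcal B\widehat\otimes\mathcal B\to\mathcal B$ be the continuous linear map with $\pi_{\mathcal B}(a\otimes b)=ab$. On $\frac{\mathcal A}{I}\widehat\otimes\frac{\mathcal A}{I}$ put $$\hat r_n(M)=\inf\Big\{\sum_{i}\hat p_n(x_i)\hat p_n(y_i):\ M=\sum_{i}x_i\otimes y_i\Big\},$$ the infimum being over all representations of $M$ as a convergent series of elementary tensors; $\mathcal A$ acts on $\frac{\mathcal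 A}{I}$ and on $\frac{\mathcal A}{I}\widehat\otimes\frac{\mathcal A}{I}$ through the quotient map $a\mapsto\tilde a=a+I$. $\mathcal A$ has a locally bounded approximate diagonal modulo $I$ if there are constants $C_n>0$ $(n\in\mathbb N)$ such that for every finite set $F\subseteq\mathcal A\setminus I$, every $n\in\mathbb N$ and every $\varepsilon>0$ there is $M\in\frac{\mathcal A}{I}\widehat\otimes\frac{\mathcal A}{I}$ with $\hat r_n(M)\le C_n$ and $$\hat r_n(a\cdot M-M\cdot a)<\varepsilon,\qquad \hat p_n\big(a\cdot\pi_{\mathcal A/I}(M)-\tilde a\big)<\varepsilon\qquad(a\in F).$$ A Fréchet algebra $\mathcal B$ has a locally bounded approximate diagonal (in Pirkovskii's sense) if for every neighbourhood $U$ of zero in $\mathcal B$ there is $C>0$ such that for every finite set $F\subseteq\mathcal B$ there is $M\in C\,\overline{\Gamma(U\otimes U)}$ with $$a\cdot M-M\cdot a\in\overline{\Gamma(U\otimes U)},\qquad a\,\pi_{\mathcal B}(M)-a\in U\qquad(a\in F),$$ where $U\otimes U=\{x\otimes y: x,y\in U\}$ and $\overline{\Gamma(\cdot)}$ is the closure in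 $\mathcal B\widehat\otimes\mathcal B$ of the absolutely convex hull. **Corollary.** Let $(\mathcal A,p_n)$ be a Fréchet algebra and $I$ a closed two-sided ideal of $\mathcal A$. If $\mathcal A$ has a locally bounded approximate diagonal modulo $I$, then $\mathcal A/I$ has a locally bounded approximate diagonal. -/

import Mathlib

open Topology Filter UniformSpace
open scoped TensorProduct ENNReal Pointwise

set_option linter.unusedSectionVars false

noncomputable section

/-! ### The completed projective tensor product of locally convex spaces -/

section ProjectiveTensor

variable (𝕜 : Type*) [RCLike 𝕜]
variable (E F G : Type*) [AddCommGroup E] [Module 𝕜 E] [TopologicalSpace E]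
  [AddCommGroup F] [Module 𝕜 F] [TopologicalSpace F]
  [AddCommGroup G] [Module 𝕜 G] [TopologicalSpace G]

/-- The algebraic tensor product of two topological vector spaces, as a type that will carry the
projective topology. -/
def ProjTensor : Type _ := E ⊗[𝕜] F

namespace ProjTensor

instance instAddCommGroup : AddCommGroup (ProjTensor 𝕜 E F) :=
  inferInstanceAs (AddCommGroup (E ⊗[𝕜] F))

instance instModule : Module 𝕜 (ProjTensor 𝕜 E F) :=
  inferInstanceAs (Module 𝕜 (E ⊗[𝕜] F))

/-- The canonical bilinear map `(x, y) ↦ x ⊗ y`. -/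
def mk : E →ₗ[𝕜] F →ₗ[𝕜] ProjTensor 𝕜 E F := TensorProduct.mk 𝕜 E F

/-- The projective topology: the finest locally convex topology on `E ⊗ F` for which the
canonical bilinear map `E × F → E ⊗ F` is jointly continuous. (Over `ℝ` or `ℂ`, a topological
vector space is locally convex exactly when its topology is given by seminorms, which is what
`PolynormableSpace` says.) -/
instance instTopologicalSpace : TopologicalSpace (ProjTensor 𝕜 E F) :=
  sInf {t | @PolynormableSpace 𝕜 (ProjTensor 𝕜 E F) _ _ _ t ∧
    @Continuous (E × F) (ProjTensor 𝕜 E F) _ t fun z => mk 𝕜 E F z.1 z.2}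

instance instPolynormableSpace : PolynormableSpace 𝕜 (ProjTensor 𝕜 E F) :=
  PolynormableSpace.sInf fun _ ht => ht.1

instance instIsTopologicalAddGroup : IsTopologicalAddGroup (ProjTensor 𝕜 E F) :=
  (PolynormableSpace.withSeminorms 𝕜 (ProjTensor 𝕜 E F)).topologicalAddGroup

instance instContinuousSMul : ContinuousSMul 𝕜 (ProjTensor 𝕜 E F) :=
  (PolynormableSpace.withSeminorms 𝕜 (ProjTensor 𝕜 E F)).continuousSMul

instance instUniformSpace : UniformSpace (ProjTensor 𝕜 E F) :=
  IsTopologicalAddGroup.rightUniformSpace (ProjTensor 𝕜 E F)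

instance instIsUniformAddGroup : IsUniformAddGroup (ProjTensor 𝕜 E F) :=
  isUniformAddGroup_of_addCommGroup

instance instUniformContinuousConstSMul : UniformContinuousConstSMul 𝕜 (ProjTensor 𝕜 E F) :=
  uniformContinuousConstSMul_of_continuousConstSMul 𝕜 (ProjTensor 𝕜 E F)

theorem continuous_mk : Continuous fun z : E × F => mk 𝕜 E F z.1 z.2 :=
  continuous_sInf_rng.2 fun _ ht => ht.2

variable {E F G}

/-- A jointly continuous bilinear map into a locally convex space induces a continuous linear map
on the projective tensor product. -/
def lift [PolynormableSpace 𝕜 G] (b : E →ₗ[𝕜] F →ₗ[𝕜] G)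
    (hb : Continuous fun z : E × F => b z.1 z.2) : ProjTensor 𝕜 E F →L[𝕜] G where
  toLinearMap := (TensorProduct.lift b : E ⊗[𝕜] F →ₗ[𝕜] G)
  cont := by
    let f : ProjTensor 𝕜 E F →ₗ[𝕜] G := (TensorProduct.lift b : E ⊗[𝕜] F →ₗ[𝕜] G)
    have hf : ∀ x y, f (mk 𝕜 E F x y) = b x y := fun x y => TensorProduct.lift.tmul x y
    refine continuous_iff_le_induced.2 (sInf_le ⟨PolynormableSpace.induced f, ?_⟩)
    rw [continuous_induced_rng]
    exact hb.congr fun z => (hf z.1 z.2).symm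

theorem lift_mk [PolynormableSpace 𝕜 G] (b : E →ₗ[𝕜] F →ₗ[𝕜] G)
    (hb : Continuous fun z : E × F => b z.1 z.2) (x : E) (y : F) :
    lift 𝕜 b hb (mk 𝕜 E F x y) = b x y :=
  TensorProduct.lift.tmul x y

end ProjTensor

/-- The completed projective tensor product `E ⊗̂ F` (the Hausdorff completion of `E ⊗ F` with the
projective topology). -/
abbrev CompletedTensor : Type _ := Completion (ProjTensor 𝕜 E F)

namespace CompletedTensor

variable {E F}

/-- The elementary tensor `x ⊗ y` in `E ⊗̂ F`. -/
def tmul (x : E) (y : F) : CompletedTensor 𝕜 E F :=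
  ((ProjTensor.mk 𝕜 E F x y : ProjTensor 𝕜 E F) : CompletedTensor 𝕜 E F)

/-- The projective tensor product of two seminorms:
`u ↦ inf {∑ᵢ p(xᵢ) q(yᵢ) : u = ∑ᵢ xᵢ ⊗ yᵢ}`, the infimum being over all representations of `u` as
the sum of a convergent series of elementary tensors. It takes values in `[0, ∞]`. -/
def projSeminorm (p : Seminorm 𝕜 E) (q : Seminorm 𝕜 F) (u : CompletedTensor 𝕜 E F) : ℝ≥0∞ :=
  ⨅ (x : ℕ → E) (y : ℕ → F) (_ : HasSum (fun i => tmul 𝕜 (x i) (y i)) u),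
    ∑' i, ENNReal.ofReal (p (x i) * q (y i))

end CompletedTensor

open scoped ComplexOrder in
/-- The absolutely convex hull `Γ(S)`. In the complex case `ℂ` has the order in which the
nonnegative elements are the nonnegative reals, so convexity has its usual meaning. -/
def absHull {𝕜 E : Type*} [RCLike 𝕜] [AddCommGroup E] [Module 𝕜 E] (S : Set E) : Set E :=
  absConvexHull 𝕜 S

end ProjectiveTensor

/-! ### Fréchet algebras -/

section Frechet

variable (𝕜 : Type*) [RCLike 𝕜]
variable {A : Type*} [NonUnitalRing A] [Module 𝕜 A] [IsScalarTower 𝕜 A A] [SMulCommClass 𝕜 A A]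

variable {𝕜} in
/-- `p` is an increasing sequence of submultiplicative seminorms that defines the topology. -/
structure IsDefiningFamily [TopologicalSpace A] (p : ℕ → Seminorm 𝕜 A) : Prop where
  monotone : Monotone p
  mul_le : ∀ n a b, p n (a * b) ≤ p n a * p n b
  withSeminorms : WithSeminorms p

variable (A) in
/-- A Fréchet algebra: an associative (not necessarily unital) algebra that is a complete
Hausdorff topological vector space whose topology is defined by an increasing sequence of
submultiplicative seminorms. -/
class IsFrechetAlgebra [UniformSpace A] [IsUniformAddGroup A] : Prop where
  completeSpace : CompleteSpace A
  t2Space : T2Space A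
  exists_family : ∃ p : ℕ → Seminorm 𝕜 A, IsDefiningFamily p

variable {𝕜} in
/-- Multiplication is jointly continuous. -/
theorem IsDefiningFamily.continuous_mul [TopologicalSpace A] {p : ℕ → Seminorm 𝕜 A}
    (hp : IsDefiningFamily p) : Continuous fun z : A × A => z.1 * z.2 := by
  have := hp.withSeminorms.topologicalAddGroup
  rw [continuous_iff_continuousAt]
  rintro ⟨a, b⟩
  refine (hp.withSeminorms.tendsto_nhds _ _).2 fun n ε hε => ?_
  have hc := hp.withSeminorms.continuous_seminorm n
  have h : Continuous fun z : A × A =>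
      p n (z.1 - a) * p n (z.2 - b) + p n (z.1 - a) * p n b + p n a * p n (z.2 - b) := by
    fun_prop
  filter_upwards [h.tendsto (a, b) |>.eventually (gt_mem_nhds (by simpa using hε))] with z hz
  refine lt_of_le_of_lt ?_ hz
  have e : z.1 * z.2 - a * b = (z.1 - a) * (z.2 - b) + (z.1 - a) * b + a * (z.2 - b) := by
    simp only [sub_mul, mul_sub]; abel
  calc p n (z.1 * z.2 - a * b)
      ≤ p n ((z.1 - a) * (z.2 - b)) + p n ((z.1 - a) * b) + p n (a * (z.2 - b)) := by
        rw [e]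
        exact (map_add_le_add _ _ _).trans (add_le_add (map_add_le_add _ _ _) le_rfl)
    _ ≤ _ := add_le_add (add_le_add (hp.mul_le _ _ _) (hp.mul_le _ _ _)) (hp.mul_le _ _ _)

variable (A) in
theorem IsFrechetAlgebra.continuous_mul [UniformSpace A] [IsUniformAddGroup A]
    [IsFrechetAlgebra 𝕜 A] : Continuous fun z : A × A => z.1 * z.2 :=
  let ⟨_, hp⟩ := IsFrechetAlgebra.exists_family (𝕜 := 𝕜) (A := A)
  hp.continuous_mul

variable (A) in
theorem IsFrechetAlgebra.polynormableSpace [UniformSpace A] [IsUniformAddGroup A]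
    [IsFrechetAlgebra 𝕜 A] : PolynormableSpace 𝕜 A :=
  let ⟨_, hp⟩ := IsFrechetAlgebra.exists_family (𝕜 := 𝕜) (A := A)
  hp.withSeminorms.toPolynormableSpace

/-! ### The bimodule structure of `A ⊗̂ A` and the diagonal operator -/

section Actions

variable [UniformSpace A] [IsUniformAddGroup A] [IsFrechetAlgebra 𝕜 A]

theorem continuous_leftBilin (a : A) : Continuous fun z : A × A =>
    ((ProjTensor.mk 𝕜 A A).comp (LinearMap.mulLeft 𝕜 a)) z.1 z.2 :=
  (ProjTensor.continuous_mk 𝕜 A A).comp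
    (((IsFrechetAlgebra.continuous_mul 𝕜 A).comp
      (continuous_const.prodMk continuous_fst)).prodMk continuous_snd)

theorem continuous_rightBilin (a : A) : Continuous fun z : A × A =>
    ((ProjTensor.mk 𝕜 A A).compl₂ (LinearMap.mulRight 𝕜 a)) z.1 z.2 :=
  (ProjTensor.continuous_mk 𝕜 A A).comp
    (continuous_fst.prodMk ((IsFrechetAlgebra.continuous_mul 𝕜 A).comp
      (continuous_snd.prodMk continuous_const)))

variable (A) in
theorem continuous_mulBilin : Continuous fun z : A × A => LinearMap.mul 𝕜 A z.1 z.2 :=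
  IsFrechetAlgebra.continuous_mul 𝕜 A

/-- The left action `M ↦ a · M` on `A ⊗̂ A`, determined by `a · (b ⊗ c) = ab ⊗ c`. -/
def leftAct (a : A) : CompletedTensor 𝕜 A A →L[𝕜] CompletedTensor 𝕜 A A :=
  (ProjTensor.lift 𝕜 ((ProjTensor.mk 𝕜 A A).comp (LinearMap.mulLeft 𝕜 a))
    (continuous_leftBilin 𝕜 a)).completion

/-- The right action `M ↦ M · a` on `A ⊗̂ A`, determined by `(b ⊗ c) · a = b ⊗ ca`. -/
def rightAct (a : A) : CompletedTensor 𝕜 A A →L[𝕜] CompletedTensor 𝕜 A A :=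
  (ProjTensor.lift 𝕜 ((ProjTensor.mk 𝕜 A A).compl₂ (LinearMap.mulRight 𝕜 a))
    (continuous_rightBilin 𝕜 a)).completion

variable (A) in
/-- The diagonal operator `π : A ⊗̂ A → A`, determined by `π (a ⊗ b) = ab`. -/
def diagonalOp : CompletedTensor 𝕜 A A →L[𝕜] A :=
  haveI := IsFrechetAlgebra.completeSpace (𝕜 := 𝕜) (A := A)
  haveI := IsFrechetAlgebra.t2Space (𝕜 := 𝕜) (A := A)
  haveI := IsFrechetAlgebra.polynormableSpace 𝕜 A
  haveI : ContinuousSMul 𝕜 A := (PolynormableSpace.withSeminorms 𝕜 A).continuousSMul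
  haveI : UniformContinuousConstSMul 𝕜 A := uniformContinuousConstSMul_of_continuousConstSMul 𝕜 A
  (ProjTensor.lift 𝕜 (LinearMap.mul 𝕜 A) (continuous_mulBilin 𝕜 A)).fromCompletion

theorem leftAct_tmul (a b c : A) :
    leftAct 𝕜 a (CompletedTensor.tmul 𝕜 b c) = CompletedTensor.tmul 𝕜 (a * b) c := by
  unfold leftAct CompletedTensor.tmul
  rw [ContinuousLinearMap.completion_apply_coe, ProjTensor.lift_mk]
  rfl

theorem rightAct_tmul (a b c : A) :
    rightAct 𝕜 a (CompletedTensor.tmul 𝕜 b c) = CompletedTensor.tmul 𝕜 b (c * a) := by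
  unfold rightAct CompletedTensor.tmul
  rw [ContinuousLinearMap.completion_apply_coe, ProjTensor.lift_mk]
  rfl

theorem diagonalOp_tmul (a b : A) : diagonalOp 𝕜 A (CompletedTensor.tmul 𝕜 a b) = a * b := by
  have := IsFrechetAlgebra.completeSpace (𝕜 := 𝕜) (A := A)
  have := IsFrechetAlgebra.t2Space (𝕜 := 𝕜) (A := A)
  have := IsFrechetAlgebra.polynormableSpace 𝕜 A
  have : ContinuousSMul 𝕜 A := (PolynormableSpace.withSeminorms 𝕜 A).continuousSMul
  have : UniformContinuousConstSMul 𝕜 A := uniformContinuousConstSMul_of_continuousConstSMul 𝕜 A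
  unfold diagonalOp CompletedTensor.tmul
  rw [ContinuousLinearMap.fromCompletion_apply_coe, ProjTensor.lift_mk]
  rfl

variable (A) in
/-- `A` has a locally bounded approximate diagonal (in the sense of Pirkovskii): for every
neighbourhood `U` of zero in `A` there is `C > 0` such that for every finite set `F ⊆ A` there is
`M ∈ C · closure (Γ(U ⊗ U))` with `a · M - M · a ∈ closure (Γ(U ⊗ U))` and `a π(M) - a ∈ U` for
all `a ∈ F`, where `U ⊗ U = {x ⊗ y : x, y ∈ U}` and the closure is taken in `A ⊗̂ A`. -/
def HasLocallyBoundedApproximateDiagonal : Prop :=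
  ∀ U ∈ 𝓝 (0 : A), ∃ C : ℝ, 0 < C ∧ ∀ F : Set A, F.Finite →
    ∃ M ∈ (C : 𝕜) • closure
        (absHull (𝕜 := 𝕜) (Set.image2 (CompletedTensor.tmul 𝕜) U U)),
      ∀ a ∈ F,
        leftAct 𝕜 a M - rightAct 𝕜 a M ∈
            closure (absHull (𝕜 := 𝕜) (Set.image2 (CompletedTensor.tmul 𝕜) U U)) ∧
          a * diagonalOp 𝕜 A M - a ∈ U

end Actions

/-! ### Quotients by closed ideals -/

variable (A) in
/-- A closed two-sided ideal of a topological algebra. -/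
structure ClosedIdeal [TopologicalSpace A] extends Submodule 𝕜 A where
  mul_mem_left' : ∀ (a : A) {x : A}, x ∈ carrier → a * x ∈ carrier
  mul_mem_right' : ∀ (a : A) {x : A}, x ∈ carrier → x * a ∈ carrier
  isClosed' : IsClosed carrier

namespace ClosedIdeal

variable {𝕜}

section Algebra

variable [TopologicalSpace A] (I : ClosedIdeal 𝕜 A)

/-- The multiplication `(a + I, b + I) ↦ ab + I`, as a bilinear map. -/
def quotMul : (A ⧸ I.toSubmodule) →ₗ[𝕜] (A ⧸ I.toSubmodule) →ₗ[𝕜] (A ⧸ I.toSubmodule) :=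
  I.toSubmodule.liftQ
    (LinearMap.flip (I.toSubmodule.liftQ
      (LinearMap.flip ((LinearMap.mul 𝕜 A).compr₂ I.toSubmodule.mkQ)) (by
        intro x hx
        rw [LinearMap.mem_ker]
        ext a
        simpa using I.mul_mem_left' a hx))) (by
    intro x hx
    rw [LinearMap.mem_ker]
    ext b
    simpa using I.mul_mem_right' b hx)

instance instMulQuotient : Mul (A ⧸ I.toSubmodule) := ⟨fun x y => I.quotMul x y⟩

theorem mk_mul (a b : A) :
    (Submodule.Quotient.mk (a * b) : A ⧸ I.toSubmodule) =
      Submodule.Quotient.mk a * Submodule.Quotient.mk b := rfl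

instance instNonUnitalRingQuotient : NonUnitalRing (A ⧸ I.toSubmodule) :=
  { (inferInstance : AddCommGroup (A ⧸ I.toSubmodule)), instMulQuotient I with
    left_distrib := fun x y z => map_add (I.quotMul x) y z
    right_distrib := fun x y z => LinearMap.map_add₂ I.quotMul x y z
    zero_mul := fun x => LinearMap.map_zero₂ I.quotMul x
    mul_zero := fun x => map_zero (I.quotMul x)
    mul_assoc := by
      intro x y z
      obtain ⟨a, rfl⟩ := Submodule.Quotient.mk_surjective _ x
      obtain ⟨b, rfl⟩ := Submodule.Quotient.mk_surjective _ y
      obtain ⟨c, rfl⟩ := Submodule.Quotient.mk_surjective _ z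
      rw [← mk_mul, ← mk_mul, ← mk_mul, ← mk_mul, mul_assoc] }

instance instIsScalarTowerQuotient :
    IsScalarTower 𝕜 (A ⧸ I.toSubmodule) (A ⧸ I.toSubmodule) :=
  ⟨fun c x y => LinearMap.map_smul₂ I.quotMul c x y⟩

instance instSMulCommClassQuotient :
    SMulCommClass 𝕜 (A ⧸ I.toSubmodule) (A ⧸ I.toSubmodule) :=
  ⟨fun c x y => (map_smul (I.quotMul x) c y).symm⟩

/-- The quotient seminorm `p̂(x) = inf {p(a) : a + I = x}`. -/
def quotSeminorm (p : Seminorm 𝕜 A) : Seminorm 𝕜 (A ⧸ I.toSubmodule) :=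
  Seminorm.ofSMulLE (fun x => sInf (p '' {a | Submodule.Quotient.mk a = x}))
    (le_antisymm (csInf_le ⟨0, by rintro _ ⟨a, -, rfl⟩; exact apply_nonneg p a⟩
        ⟨0, by simp, map_zero p⟩)
      (Real.sInf_nonneg (by rintro _ ⟨a, -, rfl⟩; exact apply_nonneg p a)))
    (by
      intro x y
      have hne : ∀ z : A ⧸ I.toSubmodule, (p '' {a | Submodule.Quotient.mk a = z}).Nonempty :=
        fun z => Set.Nonempty.image p (Submodule.Quotient.mk_surjective _ z)
      refine le_of_forall_pos_le_add fun ε hε => ?_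
      obtain ⟨_, ⟨a, ha, rfl⟩, ha'⟩ := Real.lt_sInf_add_pos (hne x) (half_pos hε)
      obtain ⟨_, ⟨b, hb, rfl⟩, hb'⟩ := Real.lt_sInf_add_pos (hne y) (half_pos hε)
      have h : sInf (p '' {a | Submodule.Quotient.mk a = x + y}) ≤ p (a + b) :=
        csInf_le ⟨0, by rintro _ ⟨a, -, rfl⟩; exact apply_nonneg p a⟩
          ⟨a + b, by
            have ha : Submodule.Quotient.mk a = x := ha
            have hb : Submodule.Quotient.mk b = y := hb
            simp [ha, hb], rfl⟩
      linarith [map_add_le_add p a b])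
    (by
      intro r x
      have hne : (p '' {a | Submodule.Quotient.mk a = x}).Nonempty :=
        Set.Nonempty.image p (Submodule.Quotient.mk_surjective _ x)
      rw [← smul_eq_mul, ← Real.sInf_smul_of_nonneg (norm_nonneg r)]
      refine le_csInf hne.smul_set ?_
      rintro _ ⟨_, ⟨a, ha, rfl⟩, rfl⟩
      refine csInf_le ⟨0, by rintro _ ⟨a, -, rfl⟩; exact apply_nonneg p a⟩
          ⟨r • a, ?_, by simp [map_smul_eq_mul]⟩
      have ha : Submodule.Quotient.mk a = x := ha
      simp [ha])

theorem quotSeminorm_eq (p : Seminorm 𝕜 A) (x : A ⧸ I.toSubmodule) :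
    I.quotSeminorm p x = sInf (p '' {a | Submodule.Quotient.mk a = x}) := rfl

theorem quotSeminorm_mk_le (p : Seminorm 𝕜 A) (a : A) :
    I.quotSeminorm p (Submodule.Quotient.mk a) ≤ p a :=
  csInf_le ⟨0, by rintro _ ⟨a, -, rfl⟩; exact apply_nonneg p a⟩ ⟨a, rfl, rfl⟩

theorem exists_lt_of_quotSeminorm_lt (p : Seminorm 𝕜 A) {x : A ⧸ I.toSubmodule} {r : ℝ}
    (h : I.quotSeminorm p x < r) : ∃ a, Submodule.Quotient.mk a = x ∧ p a < r := by
  obtain ⟨_, ⟨a, ha, rfl⟩, h'⟩ := exists_lt_of_csInf_lt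
    (Set.Nonempty.image p (Submodule.Quotient.mk_surjective I.toSubmodule x)) h
  exact ⟨a, ha, h'⟩

/-- The quotient seminorm in the form `p̂(a + I) = inf {p(a + b) : b ∈ I}`. -/
theorem quotSeminorm_mk (p : Seminorm 𝕜 A) (a : A) :
    I.quotSeminorm p (Submodule.Quotient.mk a) = ⨅ b : I.toSubmodule, p (a + b) := by
  rw [quotSeminorm_eq, iInf]
  congr 1
  ext r
  constructor
  · rintro ⟨c, hc, rfl⟩
    exact ⟨⟨c - a, (Submodule.Quotient.eq _).1 hc⟩, by simp⟩
  · rintro ⟨b, rfl⟩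
    exact ⟨a + b, (Submodule.Quotient.eq _).2 (by simp), rfl⟩

/-- The quotient seminorms define the quotient topology. -/
theorem isDefiningFamily_quotSeminorm {p : ℕ → Seminorm 𝕜 A} (hp : IsDefiningFamily p) :
    IsDefiningFamily fun n => I.quotSeminorm (p n) where
  monotone m n hmn x := by
    refine le_of_forall_gt fun r hr => ?_
    obtain ⟨a, rfl, ha⟩ := I.exists_lt_of_quotSeminorm_lt (p n) hr
    exact (I.quotSeminorm_mk_le _ a).trans_lt ((hp.monotone hmn a).trans_lt ha)
  mul_le n x y := by
    refine le_of_forall_pos_le_add fun ε hε => ?_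
    have hlim : Tendsto (fun δ : ℝ => (I.quotSeminorm (p n) x + δ) * (I.quotSeminorm (p n) y + δ))
        (𝓝[>] 0) (𝓝 (I.quotSeminorm (p n) x * I.quotSeminorm (p n) y)) := by
      refine Tendsto.mono_left ?_ nhdsWithin_le_nhds
      exact Continuous.tendsto' (by fun_prop) _ _ (by simp)
    obtain ⟨δ, hδ, hδ'⟩ := ((hlim.eventually (gt_mem_nhds (lt_add_of_pos_right _ hε))).and
      self_mem_nhdsWithin).exists
    have hδ' : 0 < δ := hδ'
    obtain ⟨a, ha, ha'⟩ := I.exists_lt_of_quotSeminorm_lt (p n) (lt_add_of_pos_right _ hδ')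
    obtain ⟨b, hb, hb'⟩ := I.exists_lt_of_quotSeminorm_lt (p n) (lt_add_of_pos_right _ hδ')
    calc I.quotSeminorm (p n) (x * y) ≤ p n (a * b) := by
          rw [← ha, ← hb, ← mk_mul]; exact I.quotSeminorm_mk_le _ _
      _ ≤ p n a * p n b := hp.mul_le _ _ _
      _ ≤ _ := mul_le_mul ha'.le hb'.le (apply_nonneg _ _)
        (add_nonneg (apply_nonneg _ _) hδ'.le)
      _ ≤ _ := hδ.le
  withSeminorms := by
    have := hp.withSeminorms.topologicalAddGroup
    rw [SeminormFamily.withSeminorms_iff_nhds_eq_iInf]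
    have h0 : 𝓝 (0 : A ⧸ I.toSubmodule) = map I.toSubmodule.mkQ (𝓝 0) := by
      rw [I.toSubmodule.isOpenQuotientMap_mkQ.map_nhds_eq, map_zero]
    refine le_antisymm (le_iInf fun n => ?_) ?_
    · rw [h0, ← tendsto_iff_comap, tendsto_map'_iff]
      refine squeeze_zero (fun a => apply_nonneg _ _) (fun a => I.quotSeminorm_mk_le (p n) a) ?_
      exact (hp.withSeminorms.continuous_seminorm n).tendsto' 0 0 (map_zero _)
    · rw [h0]
      intro S hS
      obtain ⟨s, r, hr, hs⟩ := (hp.withSeminorms.mem_nhds_iff 0 _).1 (mem_map.1 hS)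
      obtain ⟨N, hN⟩ := s.exists_le
      refine mem_iInf_of_mem N (mem_comap.2 ⟨Set.Iio r, gt_mem_nhds hr, ?_⟩)
      intro x hx
      obtain ⟨a, rfl, ha⟩ := I.exists_lt_of_quotSeminorm_lt (p N) hx
      refine hs ?_
      rw [Seminorm.mem_ball_zero]
      exact (Seminorm.finset_sup_apply_lt hr fun i hi => (hp.monotone (hN i hi) a).trans_lt ha)

end Algebra

variable [UniformSpace A] [IsUniformAddGroup A] (I : ClosedIdeal 𝕜 A)

instance instUniformSpaceQuotient : UniformSpace (A ⧸ I.toSubmodule) :=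
  IsTopologicalAddGroup.rightUniformSpace (A ⧸ I.toSubmodule)

instance instIsUniformAddGroupQuotient : IsUniformAddGroup (A ⧸ I.toSubmodule) :=
  isUniformAddGroup_of_addCommGroup

/-- The quotient of a Fréchet algebra by a closed ideal is a Fréchet algebra. -/
instance instIsFrechetAlgebraQuotient [IsFrechetAlgebra 𝕜 A] :
    IsFrechetAlgebra 𝕜 (A ⧸ I.toSubmodule) where
  completeSpace := by
    obtain ⟨p, hp⟩ := IsFrechetAlgebra.exists_family (𝕜 := 𝕜) (A := A)
    have := hp.withSeminorms.firstCountableTopology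
    have := IsFrechetAlgebra.completeSpace (𝕜 := 𝕜) (A := A)
    exact QuotientAddGroup.completeSpace_right A I.toSubmodule.toAddSubgroup
  t2Space := by
    have : IsClosed (I.toSubmodule : Set A) := I.isClosed'
    have : T3Space (A ⧸ I.toSubmodule) := inferInstance
    infer_instance
  exists_family := by
    obtain ⟨p, hp⟩ := IsFrechetAlgebra.exists_family (𝕜 := 𝕜) (A := A)
    exact ⟨_, I.isDefiningFamily_quotSeminorm hp⟩

end ClosedIdeal

/-- The Fréchet algebra `(A, pₙ)` has a locally bounded approximate diagonal modulo the closed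
ideal `I`: there are constants `Cₙ > 0` such that for every finite `F ⊆ A \ I`, every `n` and every
`ε > 0` there is `M ∈ A/I ⊗̂ A/I` with `r̂ₙ(M) ≤ Cₙ`, `r̂ₙ(a · M - M · a) < ε` and
`p̂ₙ(a · π(M) - (a + I)) < ε` for all `a ∈ F`. Here `A` acts on `A/I` and on `A/I ⊗̂ A/I` through
the quotient map, and `r̂ₙ` is the projective tensor product of `p̂ₙ` with itself. -/
def HasLocallyBoundedApproximateDiagonalModulo {𝕜 : Type*} [RCLike 𝕜] {A : Type*}
    [NonUnitalRing A] [Module 𝕜 A] [IsScalarTower 𝕜 A A] [SMulCommClass 𝕜 A A]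
    [UniformSpace A] [IsUniformAddGroup A] [IsFrechetAlgebra 𝕜 A]
    (p : ℕ → Seminorm 𝕜 A) (I : ClosedIdeal 𝕜 A) : Prop :=
  ∃ C : ℕ → ℝ, (∀ n, 0 < C n) ∧
    ∀ F : Set A, F.Finite → (∀ a ∈ F, a ∉ I.toSubmodule) → ∀ n : ℕ, ∀ ε : ℝ, 0 < ε →
      ∃ M : CompletedTensor 𝕜 (A ⧸ I.toSubmodule) (A ⧸ I.toSubmodule),
        CompletedTensor.projSeminorm 𝕜 (I.quotSeminorm (p n)) (I.quotSeminorm (p n)) M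
            ≤ ENNReal.ofReal (C n) ∧
          ∀ a ∈ F,
            CompletedTensor.projSeminorm 𝕜 (I.quotSeminorm (p n)) (I.quotSeminorm (p n))
                (leftAct 𝕜 (Submodule.Quotient.mk a : A ⧸ I.toSubmodule) M -
                  rightAct 𝕜 (Submodule.Quotient.mk a : A ⧸ I.toSubmodule) M)
                < ENNReal.ofReal ε ∧
              I.quotSeminorm (p n)
                ((Submodule.Quotient.mk a : A ⧸ I.toSubmodule) *
                    diagonalOp 𝕜 (A ⧸ I.toSubmodule) M - Submodule.Quotient.mk a) < ε

end Frechet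

end

/-! ### Absolutely convex sets and the projective seminorms -/

/-! The two notions differ in how they measure tensors: one by the seminorms `r̂ₙ`, the other by
closed absolutely convex hulls `closure Γ(U ⊗ U)`. The bridge is
`mem_smul_closure_absHull_of_projSeminorm_lt`. If `U` contains the `p̂ₙ`-ball of radius `r` and
`r̂ₙ(u) < s`, pick a series `u = ∑ xᵢ ⊗ yᵢ` of total weight below `s`. Rescaling each factor into
the ball writes every finite partial sum as a combination of points of `U ⊗ U` with coefficients
summing to at most `s / r ^ 2` (`sum_tmul_mem_smul_absHull`), and `u` is a limit of these sums.
Given `U`, the seminorms being increasing, a single `p̂ₙ`-ball of radius `r` lies in `U`. The bound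
`r̂ₙ(M) ≤ Cₙ` then gives the constant `(Cₙ + 1) / r ^ 2`, independent of `F`, and small errors fall
into the required sets. Nonzero elements of `F` lift to elements outside `I`, where the hypothesis
applies; zero satisfies both conditions trivially. -/

open scoped ComplexOrder in
/-- A nonnegative linear combination of points of a convex set lies in the dilate of the set by
the sum of the coefficients. -/
theorem Convex.sum_smul_mem_sum_smul {𝕜 E ι : Type*} [RCLike 𝕜] [AddCommGroup E] [Module 𝕜 E]
    {T : Set E} (hT : Convex 𝕜 T) (hT₀ : T.Nonempty) (s : Finset ι) (c : ι → ℝ) (z : ι → E)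
    (hc : ∀ i ∈ s, 0 ≤ c i) (hz : ∀ i ∈ s, z i ∈ T) :
    ∑ i ∈ s, (c i : 𝕜) • z i ∈ ((∑ i ∈ s, c i : ℝ) : 𝕜) • T := by
  classical
  induction s using Finset.induction_on with
  | empty => simp [Set.zero_smul_set hT₀]
  | insert i s hi ih =>
    rw [Finset.sum_insert hi, Finset.sum_insert hi]
    obtain ⟨w, hw, hw'⟩ := ih (fun j hj => hc j (Finset.mem_insert_of_mem hj))
      fun j hj => hz j (Finset.mem_insert_of_mem hj)
    have hci : 0 ≤ c i := hc i (Finset.mem_insert_self i s)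
    have hcs : 0 ≤ ∑ j ∈ s, c j :=
      Finset.sum_nonneg fun j hj => hc j (Finset.mem_insert_of_mem hj)
    have hzi := hz i (Finset.mem_insert_self i s)
    beta_reduce at hw'
    rw [← hw']
    generalize ∑ j ∈ s, c j = d at hcs
    -- The weights cannot be normalised when their total is zero; then both sides collapse to zero,
    -- which needs `T` nonempty.
    rcases (add_nonneg hci hcs).eq_or_lt with h0 | hpos
    · obtain rfl : d = 0 := by linarith
      have hi0 : c i = 0 := by linarith
      rw [hi0]
      simp [Set.zero_smul_set hT₀]
    · have hne : ((c i + d : ℝ) : 𝕜) ≠ 0 := RCLike.ofReal_ne_zero.2 hpos.ne'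
      refine ⟨((c i / (c i + d) : ℝ) : 𝕜) • z i + ((d / (c i + d) : ℝ) : 𝕜) • w,
        hT hzi hw (RCLike.ofReal_nonneg.2 (by positivity))
          (RCLike.ofReal_nonneg.2 (by positivity)) ?_, ?_⟩
      · rw [← RCLike.ofReal_add, ← add_div, div_self hpos.ne', RCLike.ofReal_one]
      · simp only [smul_add, smul_smul, ← RCLike.ofReal_mul]
        rw [mul_div_cancel₀ _ hpos.ne', mul_div_cancel₀ _ hpos.ne']

open scoped ComplexOrder in
/-- Dilates of a balanced set by real numbers increase with the factor. -/
theorem Balanced.ofReal_smul_mono {𝕜 E : Type*} [RCLike 𝕜] [AddCommGroup E] [Module 𝕜 E]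
    {T : Set E} (hT : Balanced 𝕜 T) {c d : ℝ} (hc : 0 ≤ c) (hcd : c ≤ d) :
    (c : 𝕜) • T ⊆ (d : 𝕜) • T :=
  hT.smul_mono (by
    rw [RCLike.norm_ofReal, RCLike.norm_ofReal, abs_of_nonneg hc, abs_of_nonneg (hc.trans hcd)]
    exact hcd)

namespace CompletedTensor

variable {𝕜 E F : Type*} [RCLike 𝕜] [AddCommGroup E] [Module 𝕜 E] [TopologicalSpace E]
  [AddCommGroup F] [Module 𝕜 F] [TopologicalSpace F]

theorem tmul_smul_smul (c d : 𝕜) (x : E) (y : F) :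
    tmul 𝕜 (c • x) (d • y) = (c * d) • tmul 𝕜 x y := by
  unfold tmul
  rw [map_smul, map_smul, LinearMap.smul_apply, smul_smul, mul_comm d c, Completion.coe_smul]

/-- An elementary tensor is a multiple, with factor as close as wanted to `p x * q y / r ^ 2`, of
an elementary tensor of vectors in the balls of radius `r`. -/
theorem tmul_eq_smul_tmul (x : E) (y : F) {a b r : ℝ} (ha : 0 < a) (hb : 0 < b) (hr : 0 < r) :
    tmul 𝕜 x y = ((a * b / r ^ 2 : ℝ) : 𝕜) •
      tmul 𝕜 (((r / a : ℝ) : 𝕜) • x) (((r / b : ℝ) : 𝕜) • y) := by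
  rw [tmul_smul_smul, smul_smul, ← RCLike.ofReal_mul, ← RCLike.ofReal_mul]
  have : a * b / r ^ 2 * (r / a * (r / b)) = 1 := by field_simp
  rw [this, RCLike.ofReal_one, one_smul]

theorem smul_mem_of_lt (p : Seminorm 𝕜 E) {U : Set E} {r a : ℝ} (hr : 0 < r)
    (hU : ∀ x, p x < r → x ∈ U) {x : E} (hx : p x < a) : ((r / a : ℝ) : 𝕜) • x ∈ U := by
  have ha : 0 < a := (apply_nonneg p x).trans_lt hx
  refine hU _ ?_
  rw [map_smul_eq_mul, RCLike.norm_ofReal, abs_of_pos (div_pos hr ha), div_mul_eq_mul_div,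
    div_lt_iff₀ ha]
  exact mul_lt_mul_of_pos_left hx hr

open scoped ComplexOrder in
/-- A finite sum of elementary tensors with `∑ p (x i) * q (y i) < s` lies in
`(s / r ^ 2) Γ(U ⊗ V)` if `U` and `V` contain the balls of radius `r`. -/
theorem sum_tmul_mem_smul_absHull {ι : Type*} (p : Seminorm 𝕜 E) (q : Seminorm 𝕜 F) {U : Set E}
    {V : Set F} {r s : ℝ} (hr : 0 < r) (hU : ∀ x, p x < r → x ∈ U) (hV : ∀ y, q y < r → y ∈ V)
    (S : Finset ι) (x : ι → E) (y : ι → F) (hs : ∑ i ∈ S, p (x i) * q (y i) < s) :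
    ∑ i ∈ S, tmul 𝕜 (x i) (y i) ∈
      ((s / r ^ 2 : ℝ) : 𝕜) • absHull (𝕜 := 𝕜) (Set.image2 (tmul 𝕜) U V) := by
  -- Dividing by `p (x i)` or `q (y i)` fails when one of them vanishes, so both are raised by `δ >
  -- 0`. The finite sum is continuous in `δ`, so the strict bound `s` survives for small `δ`.
  obtain ⟨δ, hδs, hδ⟩ : ∃ δ : ℝ, ∑ i ∈ S, (p (x i) + δ) * (q (y i) + δ) < s ∧ 0 < δ := by
    have hlim : Tendsto (fun δ : ℝ => ∑ i ∈ S, (p (x i) + δ) * (q (y i) + δ)) (𝓝[>] 0)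
        (𝓝 (∑ i ∈ S, p (x i) * q (y i))) :=
      (Continuous.tendsto' (by fun_prop) _ _ (by simp)).mono_left nhdsWithin_le_nhds
    exact ((hlim.eventually (gt_mem_nhds hs)).and self_mem_nhdsWithin).exists
  have hp : ∀ i, 0 < p (x i) + δ := fun i => add_pos_of_nonneg_of_pos (apply_nonneg _ _) hδ
  have hq : ∀ i, 0 < q (y i) + δ := fun i => add_pos_of_nonneg_of_pos (apply_nonneg _ _) hδ
  have hc : ∀ i ∈ S, 0 ≤ (p (x i) + δ) * (q (y i) + δ) / r ^ 2 := fun i _ =>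
    div_nonneg (mul_nonneg (hp i).le (hq i).le) (sq_nonneg r)
  have hne : (absHull (𝕜 := 𝕜) (Set.image2 (tmul 𝕜) U V)).Nonempty :=
    Set.Nonempty.mono subset_absConvexHull
      ⟨_, Set.mem_image2_of_mem (hU 0 (by simpa using hr)) (hV 0 (by simpa using hr))⟩
  rw [Finset.sum_congr rfl fun i _ => tmul_eq_smul_tmul (x i) (y i) (hp i) (hq i) hr]
  -- Convexity gives the dilate by the exact sum of the coefficients; balancedness enlarges it to `s
  -- / r ^ 2`.
  refine Balanced.ofReal_smul_mono balanced_absConvexHull (Finset.sum_nonneg hc) ?_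
    (Convex.sum_smul_mem_sum_smul convex_absConvexHull hne S _ _ hc fun i _ =>
      subset_absConvexHull (Set.mem_image2_of_mem
        (smul_mem_of_lt p hr hU (lt_add_of_pos_right _ hδ))
        (smul_mem_of_lt q hr hV (lt_add_of_pos_right _ hδ))))
  rw [← Finset.sum_div]
  exact div_le_div_of_nonneg_right hδs.le (sq_nonneg r)

/-- A tensor with projective seminorm less than `s` lies in `(s / r ^ 2) closure Γ(U ⊗ V)` if `U`
and `V` contain the balls of radius `r`. -/
theorem mem_smul_closure_absHull_of_projSeminorm_lt (p : Seminorm 𝕜 E) (q : Seminorm 𝕜 F)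
    {U : Set E} {V : Set F} {r s : ℝ} (hr : 0 < r) (hs : 0 < s) (hU : ∀ x, p x < r → x ∈ U)
    (hV : ∀ y, q y < r → y ∈ V) {u : CompletedTensor 𝕜 E F}
    (hu : projSeminorm 𝕜 p q u < ENNReal.ofReal s) :
    u ∈ ((s / r ^ 2 : ℝ) : 𝕜) •
      closure (absHull (𝕜 := 𝕜) (Set.image2 (tmul 𝕜) U V)) := by
  simp only [projSeminorm, iInf_lt_iff] at hu
  obtain ⟨x, y, hxy, hlt⟩ := hu
  have hne : ((s / r ^ 2 : ℝ) : 𝕜) ≠ 0 := RCLike.ofReal_ne_zero.2 (by positivity)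
  -- Dilation by a nonzero scalar commutes with closure, so it suffices that all finite partial sums
  -- lie in the dilated hull.
  rw [← closure_smul₀' hne]
  refine mem_closure_of_tendsto hxy (Eventually.of_forall fun S => ?_)
  refine sum_tmul_mem_smul_absHull p q hr hU hV S x y ?_
  rw [← ENNReal.ofReal_lt_ofReal_iff hs, ENNReal.ofReal_sum_of_nonneg fun i _ =>
    mul_nonneg (apply_nonneg _ _) (apply_nonneg _ _)]
  exact (ENNReal.sum_le_tsum S).trans_lt hlt

end CompletedTensor

/-! ### The action of zero on the tensor square -/

section Actions

variable {𝕜 A : Type*} [RCLike 𝕜] [NonUnitalRing A] [Module 𝕜 A] [IsScalarTower 𝕜 A A]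
  [SMulCommClass 𝕜 A A] [UniformSpace A] [IsUniformAddGroup A] [IsFrechetAlgebra 𝕜 A]

/-- Each `leftAct 𝕜 a` is built separately for fixed `a`, so linearity in `a` is not built in. At `a
= 0` the defining bilinear map vanishes, hence so does its lift to algebraic tensors, and density
with continuity does the rest. This serves the element of `A ⧸ I` that has no lift outside `I`. -/
theorem leftAct_zero (M : CompletedTensor 𝕜 A A) : leftAct 𝕜 (0 : A) M = 0 := by
  induction M using Completion.induction_on with
  | hp => exact isClosed_eq (leftAct 𝕜 (0 : A)).continuous continuous_const
  | ih u =>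
    have hb : (ProjTensor.mk 𝕜 A A).comp (LinearMap.mulLeft 𝕜 (0 : A)) = 0 := by
      ext x y
      simp
    have hu : ProjTensor.lift 𝕜 ((ProjTensor.mk 𝕜 A A).comp (LinearMap.mulLeft 𝕜 (0 : A)))
        (continuous_leftBilin 𝕜 0) u = 0 := by
      change TensorProduct.lift ((ProjTensor.mk 𝕜 A A).comp (LinearMap.mulLeft 𝕜 (0 : A))) u = 0
      rw [hb]
      exact TensorProduct.induction_on u (map_zero _) (fun _ _ => rfl)
        fun _ _ hx hy => by rw [map_add, hx, hy, add_zero]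
    unfold leftAct
    rw [ContinuousLinearMap.completion_apply_coe, hu, Completion.coe_zero]

theorem rightAct_zero (M : CompletedTensor 𝕜 A A) : rightAct 𝕜 (0 : A) M = 0 := by
  induction M using Completion.induction_on with
  | hp => exact isClosed_eq (rightAct 𝕜 (0 : A)).continuous continuous_const
  | ih u =>
    have hb : (ProjTensor.mk 𝕜 A A).compl₂ (LinearMap.mulRight 𝕜 (0 : A)) = 0 := by
      ext x y
      simp
    have hu : ProjTensor.lift 𝕜 ((ProjTensor.mk 𝕜 A A).compl₂ (LinearMap.mulRight 𝕜 (0 : A)))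
        (continuous_rightBilin 𝕜 0) u = 0 := by
      change TensorProduct.lift ((ProjTensor.mk 𝕜 A A).compl₂ (LinearMap.mulRight 𝕜 (0 : A))) u = 0
      rw [hb]
      exact TensorProduct.induction_on u (map_zero _) (fun _ _ => rfl)
        fun _ _ hx hy => by rw [map_add, hx, hy, add_zero]
    unfold rightAct
    rw [ContinuousLinearMap.completion_apply_coe, hu, Completion.coe_zero]

end Actions

/-! ### The corollary -/

theorem mainTheorem8 {𝕜 : Type*} [RCLike 𝕜] {A : Type*} [NonUnitalRing A] [Module 𝕜 A]
    [IsScalarTower 𝕜 A A] [SMulCommClass 𝕜 A A] [UniformSpace A] [IsUniformAddGroup A]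
    [IsFrechetAlgebra 𝕜 A] (p : ℕ → Seminorm 𝕜 A) (hp : IsDefiningFamily p)
    (I : ClosedIdeal 𝕜 A) (h : HasLocallyBoundedApproximateDiagonalModulo p I) :
    HasLocallyBoundedApproximateDiagonal 𝕜 (A ⧸ I.toSubmodule) := by
  obtain ⟨C, hC, hM⟩ := h
  intro U hU
  have hq := I.isDefiningFamily_quotSeminorm hp
  obtain ⟨n, r, hr, hball⟩ : ∃ n, ∃ r > 0, ∀ x, I.quotSeminorm (p n) x < r → x ∈ U := by
    obtain ⟨s, r, hr, hs⟩ := (hq.withSeminorms.mem_nhds_iff 0 _).1 hU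
    -- A basic neighbourhood involves finitely many seminorms; by monotonicity the one with a large
    -- enough index dominates them all.
    obtain ⟨N, hN⟩ := s.exists_le
    refine ⟨N, r, hr, fun x hx => hs ?_⟩
    rw [Seminorm.mem_ball_zero]
    exact Seminorm.finset_sup_apply_lt hr fun i hi => (hq.monotone (hN i hi) x).trans_lt hx
  -- The hypothesis gives `≤ C n`, while the hull lemma needs a strict bound; hence the extra `1`.
  have hC₁ : 0 < C n + 1 := add_pos (hC n) one_pos
  refine ⟨(C n + 1) / r ^ 2, by positivity, fun F hF => ?_⟩
  -- Zero is removed because its representatives lie in `I`. In the tolerance `min r (r ^ 2)`, `r`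
  -- puts `a π(M) - a` into `U`, and `r ^ 2` makes the hull factor `s / r ^ 2` equal to `1`.
  obtain ⟨M, hMC, hMF⟩ := hM ((fun x : A ⧸ I.toSubmodule => Quotient.out x) '' (F \ {0})) (hF.sdiff.image _) (by
    rintro _ ⟨x, hx, rfl⟩ hmem
    refine hx.2 ?_
    rw [Set.mem_singleton_iff, ← Quotient.out_eq x]
    exact (Submodule.Quotient.mk_eq_zero _).2 hmem) n (min r (r ^ 2)) (by positivity)
  refine ⟨M, CompletedTensor.mem_smul_closure_absHull_of_projSeminorm_lt _ _ hr hC₁ hball hball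
    (hMC.trans_lt ((ENNReal.ofReal_lt_ofReal_iff hC₁).2 (lt_add_one _))), fun x hx => ?_⟩
  have key : ∀ u, CompletedTensor.projSeminorm 𝕜 (I.quotSeminorm (p n)) (I.quotSeminorm (p n)) u
      < ENNReal.ofReal (r ^ 2) → u ∈ closure (absHull (𝕜 := 𝕜)
        (Set.image2 (CompletedTensor.tmul 𝕜) U U)) := fun u hu => by
    have := CompletedTensor.mem_smul_closure_absHull_of_projSeminorm_lt _ _ hr (sq_pos_of_pos hr)
      hball hball hu
    rwa [div_self (pow_ne_zero 2 hr.ne'), RCLike.ofReal_one, one_smul] at this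
  by_cases hx0 : x = 0
  · subst hx0
    refine ⟨?_, by simpa using mem_of_mem_nhds hU⟩
    rw [leftAct_zero, rightAct_zero, sub_zero]
    open scoped ComplexOrder in
    -- The commutator is zero, and `0 = 0 ⊗ 0` already belongs to `U ⊗ U`.
    refine subset_closure (subset_absConvexHull ⟨0, mem_of_mem_nhds hU, 0, mem_of_mem_nhds hU, ?_⟩)
    simp only [CompletedTensor.tmul, map_zero, Completion.coe_zero]
  · obtain ⟨h₁, h₂⟩ := hMF _ ⟨x, ⟨hx, hx0⟩, rfl⟩
    have hmk : (Submodule.Quotient.mk (Quotient.out x) : A ⧸ I.toSubmodule) = x :=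
      Quotient.out_eq x
    rw [hmk] at h₁ h₂
    exact ⟨key _ (h₁.trans_le (ENNReal.ofReal_le_ofReal (min_le_right _ _))),
      hball _ (h₂.trans_le (min_le_left _ _))⟩
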